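/- Let $\mathrm{Root}_k[p]$ denote the $k$-th real root, in increasing order, of the real polynomial $p$, and put $$\mu_1=\tfrac16\sqrt{\mathrm{Root}_1[-356+312x-66x^2+3x^3]}\approx 0.21821,\qquad \mu_2=\mathrm{Root}_1[-1+432x^2+2592x^3]\approx-0.14937,$$ $$\mu_3=\tfrac16,\qquad \mu_4=\mathrm{Root}_2[1-6x+18x^3]\approx 0.18595,$$ where each $\approx$ means that the two sides differ by less than $10^{-5}$ and the radicand in $\mu_1$ is non-negative. Then the Hermitian matrix $$X=(x_{ij})=\frac13\begin{pmatrix} \frac12&0&-i\mu_1&i\mu_3&i\mu_4&0\\ 0&\frac12&-i\mu_1&-i\mu_4&-(2+i)\mu_3&0\\ i\mu_1&i\mu_1&\frac12&0&0&2\mu_2+i\mu_3\\ -i\mu_3&i\mu_4&0&\frac12&0&-i\mu_1\\ -i\mu_4&(i-2)\mu_3&0&0&\frac12&i\mu_1\\ 0&0&2\mu_2-i\mu_3&i\mu_1&-i\mu_1&\frac12\end{pmatrix}$$ is positive semidefinite of rank $4$. Moreover, a *channel* on $\mathcal M_3$ (the complex $3\times3$ matrices) being a completely positive trace-preserving linear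 map $\mathcal M_3\to\mathcal M_3$, *unital* if it maps $\mathbb 1$ to $\mathbb 1$, there is a unital channel $T$ on $\mathcal M_3$ such that: 1. its Jamiołkowski state is $(\mathrm{id}\otimes T)(|\Omega\rangle\langle\Omega|)=\sum_{i,j=1}^6x_{ij}|\psi_i\rangle\langle\psi_j|$, where $|\Omega\rangle=\frac1{\sqrt3}\sum_{j=1}^3|jj\rangle$ and $$\psi_1=\tfrac1{\sqrt2}(|12\rangle+|21\rangle),\quad \psi_2=\tfrac1{\sqrt2}(|13\rangle+|31\rangle),\quad \psi_3=\tfrac1{\sqrt2}(|23\rangle+|32\rangle),$$ $$\psi_4=\tfrac1{\sqrt2\,i}(|12\rangle-|21\rangle),\quad \psi_5=\tfrac1{\sqrt2\,i}(|13\rangle-|31\rangle),\quad \psi_6=\tfrac1{\sqrt2\,i}(|23\rangle-|32\rangle);$$ 2. $T(\rho)=\sum_{k=1}^4A_k\rho A_k^\dagger$ with $\sum_kA_k^\dagger A_k=\mathbb 1$ for four linearly independent matrices $A_1,\dots,A_4\in\mathcal M_3$ such that the family $\{A_k^\dagger A_l\oplus A_lA_k^\dagger\}_{k,l=1,\dots,4}$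 is linearly independent over $\mathbb C$; 3. $T$ is an extreme point of the convex set of unital channels on $\mathcal M_3$, but not an extreme point of the convex set of all channels on $\mathcal M_3$. -/

import Mathlib

open scoped ComplexOrder

noncomputable section

namespace UnitalChannel

open Matrix Polynomial

/-- The algebra `M_d` of complex `d × d` matrices. -/
abbrev Mat (d : ℕ) : Type := Matrix (Fin d) (Fin d) ℂ

/-- The map `id_n ⊗ T` on `M_n ⊗ M_d`, which applies `T` to each `d × d` block. -/
def ampliation {d : ℕ} (n : ℕ) (T : Mat d →ₗ[ℂ] Mat d)
    (M : Matrix (Fin n × Fin d) (Fin n × Fin d) ℂ) :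
    Matrix (Fin n × Fin d) (Fin n × Fin d) ℂ :=
  Matrix.of fun p q => T (Matrix.of fun a b => M (p.1, a) (q.1, b)) p.2 q.2

/-- Complete positivity: `id_n ⊗ T` preserves positive semidefiniteness for every `n`. -/
def IsCompletelyPositive {d : ℕ} (T : Mat d →ₗ[ℂ] Mat d) : Prop :=
  ∀ (n : ℕ) (M : Matrix (Fin n × Fin d) (Fin n × Fin d) ℂ),
    M.PosSemidef → (ampliation n T M).PosSemidef

/-- The set of quantum channels on `M_d`: completely positive trace preserving linear maps. -/
def channels (d : ℕ) : Set (Mat d →ₗ[ℂ] Mat d) :=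
  {T | IsCompletelyPositive T ∧ ∀ ρ, (T ρ).trace = ρ.trace}

/-- The set of unital quantum channels on `M_d`. -/
def unitalChannels (d : ℕ) : Set (Mat d →ₗ[ℂ] Mat d) :=
  {T | T ∈ channels d ∧ T 1 = 1}

/-- `T(ρ) = ∑ i, A_i ρ A_i†` with `∑ i, A_i† A_i = 1`. -/
def IsKrausDecomposition {d N : ℕ} (T : Mat d →ₗ[ℂ] Mat d) (A : Fin N → Mat d) : Prop :=
  (∀ ρ, T ρ = ∑ i, A i * ρ * (A i)ᴴ) ∧ ∑ i, (A i)ᴴ * A i = 1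

/-- The product basis vector `|jk⟩`. -/
def ket {d : ℕ} (j k : Fin d) : Fin d × Fin d → ℂ := Pi.single (j, k) 1

/-- The rank one operator `|v⟩⟨w|`. -/
def ketBra {ι : Type*} (v w : ι → ℂ) : Matrix ι ι ℂ := vecMulVec v (star w)

/-- The maximally entangled vector `|Ω⟩ = d^{-1/2} ∑ j, |jj⟩`. -/
def maxEntangled (d : ℕ) : Fin d × Fin d → ℂ :=
  (1 / ((Real.sqrt d : ℝ) : ℂ)) • ∑ j : Fin d, ket j j

/-- The Jamiolkowski state `ρ_T = (id ⊗ T)(|Ω⟩⟨Ω|)`. -/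
def jamiolkowski {d : ℕ} (T : Mat d →ₗ[ℂ] Mat d) :
    Matrix (Fin d × Fin d) (Fin d × Fin d) ℂ :=
  ampliation d T (ketBra (maxEntangled d) (maxEntangled d))

/-- The orthonormal basis `ψ_1, …, ψ_6` of the orthogonal complement of the `|kk⟩` in `ℂ³ ⊗ ℂ³`. -/
def psi : Fin 6 → (Fin 3 × Fin 3 → ℂ) :=
  ![(1 / ((Real.sqrt 2 : ℝ) : ℂ)) • (ket 0 1 + ket 1 0),
    (1 / ((Real.sqrt 2 : ℝ) : ℂ)) • (ket 0 2 + ket 2 0),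
    (1 / ((Real.sqrt 2 : ℝ) : ℂ)) • (ket 1 2 + ket 2 1),
    (1 / (((Real.sqrt 2 : ℝ) : ℂ) * Complex.I)) • (ket 0 1 - ket 1 0),
    (1 / (((Real.sqrt 2 : ℝ) : ℂ) * Complex.I)) • (ket 0 2 - ket 2 0),
    (1 / (((Real.sqrt 2 : ℝ) : ℂ) * Complex.I)) • (ket 1 2 - ket 2 1)]

open Complex in
/-- The Hermitian matrix `X` of the Ansatz, as a function of the four real parameters. -/
def matX (μ₁ μ₂ μ₃ μ₄ : ℝ) : Matrix (Fin 6) (Fin 6) ℂ :=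
  (1 / 3 : ℂ) • !![
    1 / 2, 0, -I * μ₁, I * μ₃, I * μ₄, 0;
    0, 1 / 2, -I * μ₁, -I * μ₄, -(2 + I) * μ₃, 0;
    I * μ₁, I * μ₁, 1 / 2, 0, 0, 2 * μ₂ + I * μ₃;
    -I * μ₃, I * μ₄, 0, 1 / 2, 0, -I * μ₁;
    -I * μ₄, (I - 2) * μ₃, 0, 0, 1 / 2, I * μ₁;
    0, 0, 2 * μ₂ - I * μ₃, I * μ₁, -I * μ₁, 1 / 2]

/-- `x` is the `k`-th real root of `p ≠ 0` in increasing order, counting from `k = 1`. -/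
def IsNthRealRoot (k : ℕ) (p : ℝ[X]) (x : ℝ) : Prop :=
  p ≠ 0 ∧ p.IsRoot x ∧ (p.roots.filter (· < x)).card + 1 = k

/-- The four explicit algebraic numbers. -/
def IsSpecialParameters (μ₁ μ₂ μ₃ μ₄ : ℝ) : Prop :=
  (∃ r : ℝ, IsNthRealRoot 1 (-356 + 312 * X - 66 * X ^ 2 + 3 * X ^ 3) r ∧
    0 ≤ r ∧ μ₁ = 1 / 6 * Real.sqrt r) ∧
  IsNthRealRoot 1 (-1 + 432 * X ^ 2 + 2592 * X ^ 3) μ₂ ∧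
  μ₃ = 1 / 6 ∧
  IsNthRealRoot 2 (1 - 6 * X + 18 * X ^ 3) μ₄

end UnitalChannel

end

/-!
Let `A` be a family of Kraus operators. By Choi's theorem the completely positive maps dominated by
`∑ k, A_k ρ A_k†` are the maps `∑ k l, g_kl A_k ρ A_l†`, so a perturbation of the channel inside the
(unital) channels is a matrix `g` that satisfies the linear equation(s) of trace preservation (and
unitality). Uniqueness of `g` for both equations is the independence of
`A_k† A_l ⊕ A_l A_k†`, and gives extremality among unital channels. Without unitality the `d²`
equations cannot determine the `(card ι)²` coefficients once `card ι > d`.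

For the concrete matrix, set `y = 6 μ₄` and `m = 6 μ₁`, so that `y³ - 12 y + 12 = 0` and
`m² = 2 - y + 2 y² / 3`. In the off-diagonal product basis and up to phases, `X` is a real Gram
matrix of rank four whose kernel is spanned by two explicit vectors. The linear equations on `g` say
that the corresponding `6 × 6` matrix `U` has vanishing cyclic off-diagonals and alternating
diagonal, and `U` also annihilates these two vectors from both sides. These relations express `U`
through few entries, and the cubic equation for `y` forces it to vanish.
-/

namespace UnitalChannel

open Matrix Polynomial

section LinearAlgebra

theorem exists_mul_eq_one_of_linearIndependent_col {m n K : Type*} [Fintype m] [DecidableEq n]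
    [Field K] {V : Matrix m n K} (hV : LinearIndependent K V.col) :
    ∃ L : Matrix n m K, L * V = 1 := by
  classical
  have : Finite n := hV.finite
  cases nonempty_fintype n
  obtain ⟨f, hf⟩ := V.mulVecLin.exists_leftInverse_of_injective
    (LinearMap.ker_eq_bot.mpr (mulVec_injective_iff.mpr hV))
  refine ⟨LinearMap.toMatrix' f, ?_⟩
  rw [← LinearMap.toMatrix'_toLin' V, ← LinearMap.toMatrix'_comp]
  exact (congrArg LinearMap.toMatrix' hf).trans LinearMap.toMatrix'_id

theorem eq_zero_of_mul_mul_conjTranspose_eq_zero {m n K : Type*} [Finite m] [Fintype n]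
    [Field K] [StarRing K] {V : Matrix m n K} (hV : LinearIndependent K V.col)
    {g : Matrix n n K} (h : V * g * Vᴴ = 0) : g = 0 := by
  classical
  cases nonempty_fintype m
  obtain ⟨L, hL⟩ := exists_mul_eq_one_of_linearIndependent_col hV
  calc g = (L * V) * g * (L * V)ᴴ := by simp [hL]
    _ = L * (V * g * Vᴴ) * Lᴴ := by simp only [conjTranspose_mul, Matrix.mul_assoc]
    _ = 0 := by simp [h]

theorem exists_eq_mul_mul_conjTranspose {m n K : Type*} [Fintype m] [Fintype n] [Field K]
    [StarRing K] {V : Matrix m n K} (hV : LinearIndependent K V.col) {C : Matrix m m K}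
    (hC : C.IsHermitian) (hker : ∀ v, Vᴴ *ᵥ v = 0 → C *ᵥ v = 0) :
    ∃ g : Matrix n n K, C = V * g * Vᴴ := by
  classical
  obtain ⟨L, hL⟩ := exists_mul_eq_one_of_linearIndependent_col hV
  have hL' : Vᴴ * Lᴴ = 1 := by rw [← conjTranspose_mul, hL, conjTranspose_one]
  have hfix : C * (Lᴴ * Vᴴ) = C := by
    refine ext_of_mulVec_single fun i => ?_
    rw [← sub_eq_zero, ← mulVec_mulVec, ← mulVec_sub]
    exact hker _ (by rw [mulVec_sub, mulVec_mulVec, ← Matrix.mul_assoc, hL', Matrix.one_mul,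
      sub_self])
  have hfix' : V * L * C = C := by
    simpa [hC.eq, Matrix.mul_assoc] using congrArg conjTranspose hfix
  refine ⟨L * C * Lᴴ, ?_⟩
  calc C = V * L * C * (Lᴴ * Vᴴ) := by rw [hfix', hfix]
    _ = V * (L * C * Lᴴ) * Vᴴ := by simp only [Matrix.mul_assoc]

theorem mulVec_eq_zero_of_posSemidef_add {n 𝕜 : Type*} [Fintype n] [RCLike 𝕜]
    {C D : Matrix n n 𝕜} (hC : C.PosSemidef) (hD : D.PosSemidef) {v : n → 𝕜}
    (hv : (C + D) *ᵥ v = 0) : C *ᵥ v = 0 := by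
  rw [← hC.dotProduct_mulVec_zero_iff]
  refine ((add_eq_zero_iff_of_nonneg (hC.dotProduct_mulVec_nonneg v)
    (hD.dotProduct_mulVec_nonneg v)).mp ?_).1
  rw [← dotProduct_add, ← add_mulVec, hv, dotProduct_zero]

theorem exists_isSelfAdjoint_ne_zero_of_star_mem {E : Type*} [AddCommGroup E] [Module ℂ E]
    [StarAddMonoid E] [StarModule ℂ E] {p : Submodule ℂ E} (hp : p ≠ ⊥)
    (hstar : ∀ a ∈ p, star a ∈ p) : ∃ h ∈ p, h ≠ 0 ∧ IsSelfAdjoint h := by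
  obtain ⟨a, ha, ha0⟩ := (Submodule.ne_bot_iff p).mp hp
  by_cases hs : a + star a = 0
  · refine ⟨Complex.I • a, p.smul_mem _ ha, by simpa using ha0, ?_⟩
    simp [isSelfAdjoint_iff, star_smul, eq_neg_of_add_eq_zero_right hs]
  · exact ⟨a + star a, p.add_mem ha (hstar a ha), hs, IsSelfAdjoint.add_star_self a⟩

section CStarAlgebra

variable {E : Type*} [CStarAlgebra E] [PartialOrder E] [StarOrderedRing E]

theorem one_add_nonneg_of_norm_le_one {a : E} (ha : IsSelfAdjoint a) (hnorm : ‖a‖ ≤ 1) :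
    0 ≤ 1 + a := by
  have hle : algebraMap ℝ E ‖a‖ ≤ 1 := by
    simpa using algebraMap_mono E hnorm
  rw [← neg_le_iff_add_nonneg']
  exact (neg_le_neg hle).trans ha.neg_algebraMap_norm_le_self

theorem exists_pos_one_add_smul_nonneg {a : E} (ha : IsSelfAdjoint a) :
    ∃ c : ℝ, 0 < c ∧ 0 ≤ 1 + c • a ∧ 0 ≤ 1 + -c • a := by
  have hpos : 0 < 1 + ‖a‖ := by positivity
  have hnorm : ‖(1 + ‖a‖)⁻¹ • a‖ ≤ 1 := by
    rw [norm_smul, norm_inv, Real.norm_of_nonneg hpos.le, inv_mul_le_one₀ hpos]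
    linarith
  have hsa : IsSelfAdjoint ((1 + ‖a‖)⁻¹ • a) := (IsSelfAdjoint.all _).smul ha
  refine ⟨(1 + ‖a‖)⁻¹, inv_pos.mpr hpos, one_add_nonneg_of_norm_le_one hsa hnorm, ?_⟩
  rw [neg_smul]
  exact one_add_nonneg_of_norm_le_one hsa.neg (by rwa [norm_neg])

end CStarAlgebra

end LinearAlgebra

section KrausForm

variable {d : ℕ} {ι : Type*} [Fintype ι]

/-- The map `ρ ↦ ∑ k l, g k l • A k * ρ * (A l)ᴴ`, linear in the coefficient matrix `g`.
The Kraus decomposition with operators `A` is the case `g = 1`. -/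
def krausForm (A : ι → Mat d) : Matrix ι ι ℂ →ₗ[ℂ] Mat d →ₗ[ℂ] Mat d :=
  ∑ k, ∑ l, (entryLinearMap ℂ ℂ k l).smulRight (LinearMap.mulLeftRight ℂ (A k, (A l)ᴴ))

/-- The value at `1` of the trace dual of `krausForm A g`. -/
def krausDual (A : ι → Mat d) : Matrix ι ι ℂ →ₗ[ℂ] Mat d :=
  ∑ k, ∑ l, (entryLinearMap ℂ ℂ k l).smulRight ((A l)ᴴ * A k)

theorem krausForm_apply (A : ι → Mat d) (g : Matrix ι ι ℂ) (ρ : Mat d) :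
    krausForm A g ρ = ∑ k, ∑ l, g k l • (A k * ρ * (A l)ᴴ) := by
  simp [krausForm, LinearMap.sum_apply]

theorem krausDual_apply (A : ι → Mat d) (g : Matrix ι ι ℂ) :
    krausDual A g = ∑ k, ∑ l, g k l • ((A l)ᴴ * A k) := by
  simp [krausDual, LinearMap.sum_apply]

theorem krausDual_conjTranspose (A : ι → Mat d) (g : Matrix ι ι ℂ) :
    krausDual A gᴴ = (krausDual A g)ᴴ := by
  simp only [krausDual_apply, conjTranspose_sum, conjTranspose_smul, conjTranspose_mul,
    conjTranspose_conjTranspose, conjTranspose_apply]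
  exact Finset.sum_comm

theorem trace_krausForm (A : ι → Mat d) (g : Matrix ι ι ℂ) (ρ : Mat d) :
    (krausForm A g ρ).trace = (krausDual A g * ρ).trace := by
  simp only [krausForm_apply, krausDual_apply, trace_sum, trace_smul, Finset.sum_mul,
    smul_mul_assoc]
  refine Finset.sum_congr rfl fun k _ => Finset.sum_congr rfl fun l _ => ?_
  rw [trace_mul_comm, ← Matrix.mul_assoc]

theorem forall_trace_krausForm_eq_iff {A : ι → Mat d} {g : Matrix ι ι ℂ} :
    (∀ ρ, (krausForm A g ρ).trace = ρ.trace) ↔ krausDual A g = 1 := by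
  simp only [trace_krausForm, Matrix.ext_iff_trace_mul_right, Matrix.one_mul]

theorem isKrausDecomposition_krausForm_one {N : ℕ} {A : Fin N → Mat d}
    (hA : krausDual A 1 = 1) : IsKrausDecomposition (krausForm A 1) A := by
  constructor
  · simp [krausForm_apply, one_apply, ite_smul]
  · simpa [krausDual_apply, one_apply, ite_smul] using hA

theorem ampliation_krausForm (n : ℕ) (A : ι → Mat d) (g : Matrix ι ι ℂ)
    (M : Matrix (Fin n × Fin d) (Fin n × Fin d) ℂ) :
    letI W : Matrix (Fin n × Fin d) ((Fin n × Fin d) × ι) ℂ :=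
      of fun p q => if p.1 = q.1.1 then A q.2 p.2 q.1.2 else 0
    ampliation n (krausForm A g) M = W * kronecker M g * Wᴴ := by
  ext ⟨i, a⟩ ⟨j, b⟩
  suffices ∑ k, ∑ l, ∑ b', ∑ a', g k l * (A k a a' * M (i, a') (j, b') * star (A l b b')) =
      ∑ b', ∑ l, ∑ a', ∑ k, A k a a' * (M (i, a') (j, b') * g k l) * star (A l b b') by
    simpa [ampliation, krausForm_apply, Matrix.sum_apply, Matrix.mul_apply,
      Fintype.sum_prod_type, kronecker, apply_ite (starRingEnd ℂ), Finset.sum_ite_irrel,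
      Finset.sum_mul, Finset.mul_sum] using this
  calc _ = ∑ l, ∑ k, ∑ b', ∑ a', g k l * (A k a a' * M (i, a') (j, b') * star (A l b b')) :=
        Finset.sum_comm
    _ = ∑ l, ∑ b', ∑ a', ∑ k, A k a a' * (M (i, a') (j, b') * g k l) * star (A l b b') := by
        refine Finset.sum_congr rfl fun l _ => Finset.sum_comm.trans ?_
        refine Finset.sum_congr rfl fun b' _ => Finset.sum_comm.trans ?_
        exact Finset.sum_congr rfl fun a' _ => Finset.sum_congr rfl fun k _ => by ring
    _ = _ := Finset.sum_comm

theorem isCompletelyPositive_krausForm (A : ι → Mat d) {g : Matrix ι ι ℂ} (hg : g.PosSemidef) :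
    IsCompletelyPositive (krausForm A g) := by
  intro n M hM
  rw [ampliation_krausForm]
  exact (hM.kronecker hg).mul_mul_conjTranspose_same _

theorem krausForm_mem_channels {A : ι → Mat d} {g : Matrix ι ι ℂ} (hg : g.PosSemidef)
    (hdual : krausDual A g = 1) : krausForm A g ∈ channels d :=
  ⟨isCompletelyPositive_krausForm A hg, forall_trace_krausForm_eq_iff.mpr hdual⟩

end KrausForm

section Choi

variable {d : ℕ} {ι : Type*} [Fintype ι]

/-- The Choi matrix of `T`, which is `d` times its Jamiolkowski state. -/
def choi : (Mat d →ₗ[ℂ] Mat d) →ₗ[ℂ] Matrix (Fin d × Fin d) (Fin d × Fin d) ℂ where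
  toFun T := of fun p q => T (single p.1 q.1 1) p.2 q.2
  map_add' _ _ := rfl
  map_smul' _ _ := rfl

theorem choi_apply (T : Mat d →ₗ[ℂ] Mat d) (p q : Fin d × Fin d) :
    choi T p q = T (single p.1 q.1 1) p.2 q.2 :=
  rfl

theorem choi_injective : Function.Injective (choi (d := d)) := by
  intro S T h
  refine Matrix.ext_linearMap ℂ fun i j => LinearMap.ext_ring ?_
  ext a b
  exact congrFun₂ h (i, a) (j, b)

theorem sum_ket_apply (i a : Fin d) : (∑ j : Fin d, ket j j) (i, a) = if i = a then 1 else 0 := by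
  simp [ket, Finset.sum_apply, Pi.single_apply, Prod.ext_iff, ite_and, eq_comm]

theorem ampliation_ketBra_sum_ket (T : Mat d →ₗ[ℂ] Mat d) :
    ampliation d T (ketBra (∑ j, ket j j) (∑ j, ket j j)) = choi T := by
  have hblock (i j : Fin d) : (of fun a b => ketBra (∑ j, ket j j) (∑ j, ket j j) (i, a) (j, b)) =
      (single i j 1 : Mat d) := by
    ext a b
    simp only [of_apply, ketBra, vecMulVec_apply, Pi.star_apply, sum_ket_apply, single_apply]
    by_cases hi : i = a <;> by_cases hj : j = b <;> simp [hi, hj]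
  ext p q
  simp only [ampliation, of_apply, hblock, choi_apply]

theorem ketBra_maxEntangled (d : ℕ) : ketBra (maxEntangled d) (maxEntangled d) =
    (1 / (d : ℂ)) • ketBra (∑ j, ket j j) (∑ j, ket j j) := by
  have hsq : (√d : ℂ) * √d = d := by exact_mod_cast Real.mul_self_sqrt (Nat.cast_nonneg d)
  have hscalar : star (1 / (√d : ℂ)) * (1 / (√d : ℂ)) = 1 / d := by
    rw [Complex.star_def, map_div₀, map_one, Complex.conj_ofReal, div_mul_div_comm, one_mul, hsq]
  rw [maxEntangled, ketBra, star_smul, vecMulVec_smul, smul_vecMulVec, smul_smul, hscalar, ketBra]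

theorem jamiolkowski_eq_smul_choi (T : Mat d →ₗ[ℂ] Mat d) :
    jamiolkowski T = (1 / (d : ℂ)) • choi T := by
  rw [jamiolkowski, ketBra_maxEntangled, ← ampliation_ketBra_sum_ket]
  ext p q
  exact congrFun₂ (map_smul T (1 / (d : ℂ)) (of fun a b => ketBra _ _ (p.1, a) (q.1, b))) p.2 q.2

theorem posSemidef_choi {T : Mat d →ₗ[ℂ] Mat d} (hT : IsCompletelyPositive T) :
    (choi T).PosSemidef := by
  rw [← ampliation_ketBra_sum_ket]
  exact hT d _ (posSemidef_vecMulVec_self_star _)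

/-- The matrix whose columns are the Kraus operators `A k`, flattened with the column index of
`A k` first, as in the first tensor factor of `choi`. -/
def krausMatrix (A : ι → Mat d) : Matrix (Fin d × Fin d) ι ℂ :=
  of fun p k => A k p.2 p.1

theorem choi_krausForm (A : ι → Mat d) (g : Matrix ι ι ℂ) :
    choi (krausForm A g) = krausMatrix A * g * (krausMatrix A)ᴴ := by
  ext p q
  suffices ∑ k, ∑ l, g k l * (A k p.2 p.1 * star (A l q.2 q.1)) =
      ∑ l, ∑ k, A k p.2 p.1 * g k l * star (A l q.2 q.1) by
    simpa [choi_apply, krausForm_apply, krausMatrix, Matrix.sum_apply, Matrix.mul_apply,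
      single_apply, ite_and, Finset.sum_mul] using this
  rw [Finset.sum_comm]
  exact Finset.sum_congr rfl fun l _ => Finset.sum_congr rfl fun k _ => by ring

theorem linearIndependent_col_krausMatrix {ι : Type*} {A : ι → Mat d}
    (hA : LinearIndependent ℂ A) : LinearIndependent ℂ (krausMatrix A).col := by
  let flatten : Mat d →ₗ[ℂ] Fin d × Fin d → ℂ :=
    LinearMap.pi fun p => entryLinearMap ℂ ℂ p.2 p.1
  refine hA.map' flatten (LinearMap.ker_eq_bot.mpr fun B C h => ?_)
  ext i j
  exact congrFun h (j, i)

theorem krausForm_injective {A : ι → Mat d} (hA : LinearIndependent ℂ A) :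
    Function.Injective (krausForm A) := by
  refine (injective_iff_map_eq_zero _).mpr fun g hg => ?_
  refine eq_zero_of_mul_mul_conjTranspose_eq_zero (linearIndependent_col_krausMatrix hA) ?_
  rw [← choi_krausForm, hg, map_zero]

end Choi

section ExtremePoints

open scoped MatrixOrder Matrix.Norms.L2Operator

variable {d : ℕ} {ι : Type*} [Fintype ι]

/-- The family `A_k† A_l ⊕ A_l A_k†` of the Landau–Streater criterion for extremality among
unital channels. -/
def krausProducts (A : ι → Mat d) (kl : ι × ι) : Matrix (Fin d ⊕ Fin d) (Fin d ⊕ Fin d) ℂ :=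
  fromBlocks ((A kl.1)ᴴ * A kl.2) 0 0 (A kl.2 * (A kl.1)ᴴ)

theorem sum_smul_krausProducts (A : ι → Mat d) (g : Matrix ι ι ℂ) :
    ∑ kl : ι × ι, g kl.2 kl.1 • krausProducts A kl =
      fromBlocks (krausDual A g) 0 0 (krausForm A g 1) := by
  rw [Fintype.sum_prod_type_right]
  ext (i | i) (j | j) <;>
    simp [krausProducts, krausDual_apply, krausForm_apply, Matrix.sum_apply]

theorem linearIndependent_krausProducts_iff {A : ι → Mat d} :
    LinearIndependent ℂ (krausProducts A) ↔
      ∀ g, krausDual A g = 0 → krausForm A g 1 = 0 → g = 0 := by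
  rw [Fintype.linearIndependent_iff]
  constructor
  · intro h g hdual hone
    ext k l
    refine h (fun kl => g kl.2 kl.1) ?_ (l, k)
    rw [sum_smul_krausProducts, hdual, hone, fromBlocks_zero]
  · intro h c hc kl
    have hsum := sum_smul_krausProducts A (of fun k l => c (l, k))
    simp only [of_apply, Prod.mk.eta, hc, ← fromBlocks_zero, fromBlocks_inj] at hsum
    exact congrFun₂ (h _ hsum.1.symm hsum.2.2.2.symm) kl.2 kl.1

theorem linearIndependent_of_krausProducts {ι : Type*} [Finite ι] {A : ι → Mat d}
    (hA : LinearIndependent ℂ (krausProducts A)) : LinearIndependent ℂ A := by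
  cases nonempty_fintype ι
  refine Fintype.linearIndependent_iff.mpr fun c hc k => ?_
  have hdual : krausDual A (vecMulVec c 1) = 0 := by
    rw [krausDual_apply, Finset.sum_comm]
    simp only [vecMulVec_apply, Pi.one_apply, mul_one, ← Matrix.mul_smul, ← Finset.mul_sum, hc,
      Matrix.mul_zero, Finset.sum_const_zero]
  have hone : krausForm A (vecMulVec c 1) 1 = 0 := by
    rw [krausForm_apply, Finset.sum_comm]
    simp only [vecMulVec_apply, Pi.one_apply, mul_one, ← Matrix.smul_mul, ← Finset.sum_mul, hc,
      Matrix.zero_mul, Finset.sum_const_zero]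
  simpa [vecMulVec_apply] using
    congrFun₂ (linearIndependent_krausProducts_iff.mp hA _ hdual hone) k k

theorem isCompletelyPositive_smul {T : Mat d →ₗ[ℂ] Mat d} (hT : IsCompletelyPositive T) {a : ℝ}
    (ha : 0 ≤ a) : IsCompletelyPositive (a • T) :=
  fun n M hM => (hT n M hM).smul ha

variable [DecidableEq ι]

theorem exists_eq_krausForm_of_add_eq {A : ι → Mat d} (hA : LinearIndependent ℂ A)
    {S T : Mat d →ₗ[ℂ] Mat d} (hS : IsCompletelyPositive S) (hT : IsCompletelyPositive T)
    (hST : S + T = krausForm A 1) : ∃ g, S = krausForm A g := by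
  have hker (v) (hv : (krausMatrix A)ᴴ *ᵥ v = 0) : choi S *ᵥ v = 0 := by
    refine mulVec_eq_zero_of_posSemidef_add (posSemidef_choi hS) (posSemidef_choi hT) ?_
    rw [← map_add, hST, choi_krausForm, ← mulVec_mulVec, hv, mulVec_zero]
  obtain ⟨g, hg⟩ := exists_eq_mul_mul_conjTranspose (linearIndependent_col_krausMatrix hA)
    (posSemidef_choi hS).isHermitian hker
  exact ⟨g, choi_injective (by rw [hg, choi_krausForm])⟩

theorem krausForm_one_mem_extremePoints_unitalChannels {A : ι → Mat d}
    (hmem : krausForm A 1 ∈ unitalChannels d) (hA : LinearIndependent ℂ (krausProducts A)) :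
    krausForm A 1 ∈ Set.extremePoints ℝ (unitalChannels d) := by
  refine mem_extremePoints_iff_left.mpr ⟨hmem, ?_⟩
  rintro S ⟨⟨hS, hStr⟩, hS1⟩ T ⟨⟨hT, -⟩, -⟩ ⟨a, b, ha, hb, -, hab⟩
  obtain ⟨g, hg⟩ := exists_eq_krausForm_of_add_eq (linearIndependent_of_krausProducts hA)
    (isCompletelyPositive_smul hS ha.le) (isCompletelyPositive_smul hT hb.le) hab
  obtain rfl : S = krausForm A (a⁻¹ • g) := by
    rw [LinearMap.map_smul_of_tower, ← hg, inv_smul_smul₀ ha.ne']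
  have hdual : krausDual A (a⁻¹ • g - 1) = 0 := by
    rw [map_sub, forall_trace_krausForm_eq_iff.mp hStr,
      forall_trace_krausForm_eq_iff.mp hmem.1.2, sub_self]
  have hone : krausForm A (a⁻¹ • g - 1) 1 = 0 := by
    rw [map_sub, LinearMap.sub_apply, hS1, hmem.2, sub_self]
  rw [sub_eq_zero.mp (linearIndependent_krausProducts_iff.mp hA _ hdual hone)]

theorem krausForm_one_notMem_extremePoints_channels {A : ι → Mat d} (hA : LinearIndependent ℂ A)
    (hdual : krausDual A 1 = 1) (hcard : d < Fintype.card ι) :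
    krausForm A 1 ∉ Set.extremePoints ℝ (channels d) := by
  have hbot : LinearMap.ker (krausDual A) ≠ ⊥ := LinearMap.ker_ne_bot_of_finrank_lt <| by
    simpa [Module.finrank_matrix] using Nat.mul_lt_mul'' hcard hcard
  obtain ⟨h, hker, hne, hsa⟩ := exists_isSelfAdjoint_ne_zero_of_star_mem hbot fun g hg => by
    rw [LinearMap.mem_ker] at hg ⊢
    rw [star_eq_conjTranspose, krausDual_conjTranspose, hg, conjTranspose_zero]
  obtain ⟨c, hc, hpos, hneg⟩ := exists_pos_one_add_smul_nonneg hsa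
  have hmem (t : ℝ) (ht : 0 ≤ 1 + t • h) : krausForm A (1 + t • h) ∈ channels d := by
    refine krausForm_mem_channels (nonneg_iff_posSemidef.mp ht) ?_
    rw [map_add, LinearMap.map_smul_of_tower, hker, smul_zero, add_zero, hdual]
  intro hext
  have heq : krausForm A (1 + c • h) = krausForm A 1 := by
    refine (mem_extremePoints_iff_left.mp hext).2 _ (hmem c hpos) _ (hmem (-c) hneg)
      ⟨1 / 2, 1 / 2, by norm_num, by norm_num, by norm_num, ?_⟩
    rw [← LinearMap.map_smul_of_tower, ← LinearMap.map_smul_of_tower, ← map_add]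
    congr 1
    module
  exact hne ((smul_eq_zero.mp (add_eq_left.mp (krausForm_injective hA heq))).resolve_left hc.ne')

end ExtremePoints

section OffDiagonal

variable {d : ℕ}

theorem apply_one_eq_sum_choi (T : Mat d →ₗ[ℂ] Mat d) (i j : Fin d) :
    T 1 i j = ∑ b, choi T (b, i) (b, j) := by
  simp only [choi_apply, ← Matrix.sum_apply, ← map_sum, sum_single_eq_diagonal, diagonal_one]

theorem krausDual_apply_eq_sum_choi {ι : Type*} [Fintype ι] (A : ι → Mat d) (g : Matrix ι ι ℂ)
    (i j : Fin d) : krausDual A g i j = ∑ a, choi (krausForm A g) (j, a) (i, a) := by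
  suffices ∑ k, ∑ l, ∑ a, g k l * (star (A l a i) * A k a j) =
      ∑ a, ∑ k, ∑ l, g k l * (A k a j * star (A l a i)) by
    simpa [choi_apply, krausForm_apply, krausDual_apply, Matrix.sum_apply, Matrix.mul_apply,
      single_apply, ite_and, Finset.mul_sum] using this
  calc _ = ∑ k, ∑ a, ∑ l, g k l * (A k a j * star (A l a i)) := by
        refine Finset.sum_congr rfl fun k _ => Finset.sum_comm.trans ?_
        simp only [mul_comm (star _)]
    _ = _ := Finset.sum_comm

/-- The conditions on the off-diagonal coordinates of the Choi matrix of a map on `M_3` under which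
both partial traces vanish. -/
structure IsCyclicallyAlternating {K : Type*} [Field K] (U : Matrix (Fin 6) (Fin 6) K) : Prop where
  succ_right (a : Fin 6) : U a (a + 1) = 0
  succ_left (a : Fin 6) : U (a + 1) a = 0
  diag (a : Fin 6) : U (a + 1) (a + 1) = -U a a

/-- The position of the `a`-th off-diagonal basis vector of `ℂ³ ⊗ ℂ³`. The order is chosen so that
the vanishing of both partial traces becomes the cyclic condition `IsCyclicallyAlternating`. -/
def offDiagIndex : Fin 6 → Fin 3 × Fin 3 :=
  ![(0, 1), (0, 2), (1, 2), (1, 0), (2, 0), (2, 1)]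

/-- The isometry `ℂ⁶ → ℂ³ ⊗ ℂ³` onto the span of the vectors `|jk⟩` with `j ≠ k`. -/
def offDiagEmbedding : Matrix (Fin 3 × Fin 3) (Fin 6) ℂ :=
  of fun p a => if p = offDiagIndex a then 1 else 0

theorem offDiagEmbedding_apply (p : Fin 3 × Fin 3) (a : Fin 6) :
    offDiagEmbedding p a = if p = offDiagIndex a then 1 else 0 :=
  rfl

/-- The matrix in `M_3` with zero diagonal whose flattening, in the sense of `krausMatrix`, is
`offDiagEmbedding *ᵥ f`. -/
def offDiag : (Fin 6 → ℂ) →ₗ[ℂ] Mat 3 where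
  toFun f := !![0, f 3, f 4; f 0, 0, f 5; f 1, f 2, 0]
  map_add' f g := by simp
  map_smul' c f := by simp

theorem offDiag_apply (f : Fin 6 → ℂ) : offDiag f = !![0, f 3, f 4; f 0, 0, f 5; f 1, f 2, 0] :=
  rfl

theorem krausMatrix_offDiag {ι : Type*} (C : Matrix (Fin 6) ι ℂ) :
    krausMatrix (fun k => offDiag (C.col k)) = offDiagEmbedding * C := by
  ext ⟨i, j⟩ k
  fin_cases i <;> fin_cases j <;>
    simp [krausMatrix, offDiag_apply, offDiagEmbedding_apply, offDiagIndex, Matrix.mul_apply,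
      Fin.sum_univ_six]

variable {ι : Type*} [Fintype ι]

theorem choi_krausForm_offDiag (C : Matrix (Fin 6) ι ℂ) (g : Matrix ι ι ℂ) :
    choi (krausForm (fun k => offDiag (C.col k)) g) =
      offDiagEmbedding * (C * g * Cᴴ) * offDiagEmbeddingᴴ := by
  rw [choi_krausForm, krausMatrix_offDiag, conjTranspose_mul]
  simp only [Matrix.mul_assoc]

theorem krausForm_offDiag_one (C : Matrix (Fin 6) ι ℂ) (g : Matrix ι ι ℂ) :
    letI S := C * g * Cᴴ
    krausForm (fun k => offDiag (C.col k)) g 1 =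
      !![S 3 3 + S 4 4, S 4 5, S 3 2; S 5 4, S 0 0 + S 5 5, S 0 1;
        S 2 3, S 1 0, S 1 1 + S 2 2] := by
  generalize hS : C * g * Cᴴ = S
  ext i j
  rw [apply_one_eq_sum_choi, choi_krausForm_offDiag, hS]
  fin_cases i <;> fin_cases j <;>
    simp [offDiagEmbedding_apply, offDiagIndex, Matrix.mul_apply, Fin.sum_univ_three,
      Fin.sum_univ_six]

theorem krausDual_offDiag (C : Matrix (Fin 6) ι ℂ) (g : Matrix ι ι ℂ) :
    letI S := C * g * Cᴴ
    krausDual (fun k => offDiag (C.col k)) g =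
      !![S 0 0 + S 1 1, S 2 1, S 5 0; S 1 2, S 3 3 + S 2 2, S 4 3;
        S 0 5, S 3 4, S 4 4 + S 5 5] := by
  generalize hS : C * g * Cᴴ = S
  ext i j
  rw [krausDual_apply_eq_sum_choi, choi_krausForm_offDiag, hS]
  fin_cases i <;> fin_cases j <;>
    simp [offDiagEmbedding_apply, offDiagIndex, Matrix.mul_apply, Fin.sum_univ_three,
      Fin.sum_univ_six]

theorem isCyclicallyAlternating_of_krausDual_eq_zero {C : Matrix (Fin 6) ι ℂ} {g : Matrix ι ι ℂ}
    (hdual : krausDual (fun k => offDiag (C.col k)) g = 0)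
    (hone : krausForm (fun k => offDiag (C.col k)) g 1 = 0) :
    IsCyclicallyAlternating (C * g * Cᴴ) := by
  rw [krausDual_offDiag] at hdual
  rw [krausForm_offDiag_one] at hone
  generalize C * g * Cᴴ = S at hdual hone
  have hd (i j) := congrFun₂ hdual i j
  have ho (i j) := congrFun₂ hone i j
  refine ⟨fun a => ?_, fun a => ?_, fun a => ?_⟩ <;> fin_cases a
  exacts [ho 1 2, hd 1 0, ho 2 0, hd 2 1, ho 0 1, hd 0 2,
    ho 2 1, hd 0 1, ho 0 2, hd 1 2, ho 1 0, hd 2 0,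
    eq_neg_of_add_eq_zero_right (hd 0 0), eq_neg_of_add_eq_zero_right (ho 2 2),
    eq_neg_of_add_eq_zero_left (hd 1 1), eq_neg_of_add_eq_zero_right (ho 0 0),
    eq_neg_of_add_eq_zero_right (hd 2 2), eq_neg_of_add_eq_zero_left (ho 1 1)]

end OffDiagonal

section Rigidity

variable {K : Type*} [Field K]

/-- Two vectors spanning the kernel of the real Gram matrix `gram y m`. The parameters lie in an
arbitrary field because the relations are needed over `ℝ` and over `ℂ`. -/
def kernelVec (y m : K) : Fin 2 → Fin 6 → K :=
  ![![(4 - 3 * y) * (4 + y), -8, m * y * (4 + y), -2 * y, -(16 - y ^ 2), 0],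
    ![-2 * m, m * (2 - y), 4, m * (2 - y), 0, -((4 - y) * (2 - y))]]

variable {y m : K} {U : Matrix (Fin 6) (Fin 6) K}

theorem dotProduct_kernelVec_zero (u : Fin 6 → K) :
    u ⬝ᵥ kernelVec y m 0 = (4 - 3 * y) * (4 + y) * u 0 - 8 * u 1 + m * y * (4 + y) * u 2 -
      2 * y * u 3 - (16 - y ^ 2) * u 4 := by
  rw [dotProduct, Fin.sum_univ_six]
  change u 0 * ((4 - 3 * y) * (4 + y)) + u 1 * -8 + u 2 * (m * y * (4 + y)) + u 3 * (-2 * y) +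
    u 4 * -(16 - y ^ 2) + u 5 * 0 = _
  ring

theorem dotProduct_kernelVec_one (u : Fin 6 → K) :
    u ⬝ᵥ kernelVec y m 1 = -2 * m * u 0 + m * (2 - y) * (u 1 + u 3) + 4 * u 2 -
      (4 - y) * (2 - y) * u 5 := by
  rw [dotProduct, Fin.sum_univ_six]
  change u 0 * (-2 * m) + u 1 * (m * (2 - y)) + u 2 * 4 + u 3 * (m * (2 - y)) + u 4 * 0 +
    u 5 * -((4 - y) * (2 - y)) = _
  ring

namespace IsCyclicallyAlternating

theorem transpose (hU : IsCyclicallyAlternating U) : IsCyclicallyAlternating Uᵀ :=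
  ⟨hU.succ_left, hU.succ_right, hU.diag⟩

theorem diag_eq (hU : IsCyclicallyAlternating U) :
    U 1 1 = -U 0 0 ∧ U 2 2 = U 0 0 ∧ U 3 3 = -U 0 0 ∧ U 4 4 = U 0 0 := by
  have h1 : U 1 1 = -U 0 0 := hU.diag 0
  have h2 : U 2 2 = -U 1 1 := hU.diag 1
  have h3 : U 3 3 = -U 2 2 := hU.diag 2
  have h4 : U 4 4 = -U 3 3 := hU.diag 3
  simp [h1, h2, h3, h4]

theorem entries_of_mulVec_kernelVec (hU : IsCyclicallyAlternating U)
    (hker : ∀ j, U *ᵥ kernelVec y m j = 0) :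
    8 * U 3 1 = (4 - 3 * y) * (4 + y) * U 3 0 + 2 * y * U 0 0 ∧
      4 * U 0 2 = m * (2 * U 0 0 - (2 - y) * U 0 3) := by
  have row₃ : U 3 ⬝ᵥ kernelVec y m 0 = 0 := congrFun (hker 0) 3
  have row₀ : U 0 ⬝ᵥ kernelVec y m 1 = 0 := congrFun (hker 1) 0
  rw [dotProduct_kernelVec_zero] at row₃
  rw [dotProduct_kernelVec_one] at row₀
  have h01 : U 0 1 = 0 := hU.succ_right 0
  have h05 : U 0 5 = 0 := hU.succ_left 5
  have h32 : U 3 2 = 0 := hU.succ_left 2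
  have h34 : U 3 4 = 0 := hU.succ_right 3
  obtain ⟨-, -, h33, -⟩ := hU.diag_eq
  rw [h32, h33, h34] at row₃
  rw [h01, h05] at row₀
  exact ⟨by linear_combination -row₃, by linear_combination row₀⟩

theorem row_four_of_mulVec_kernelVec (hU : IsCyclicallyAlternating U)
    (hker : ∀ j, U *ᵥ kernelVec y m j = 0) :
    (4 - 3 * y) * (4 + y) * U 4 0 - 8 * U 4 1 + m * y * (4 + y) * U 4 2 =
        (16 - y ^ 2) * U 0 0 ∧
      4 * U 4 2 = m * (2 * U 4 0 - (2 - y) * U 4 1) := by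
  have hzero : U 4 ⬝ᵥ kernelVec y m 0 = 0 := congrFun (hker 0) 4
  have hone : U 4 ⬝ᵥ kernelVec y m 1 = 0 := congrFun (hker 1) 4
  rw [dotProduct_kernelVec_zero] at hzero
  rw [dotProduct_kernelVec_one] at hone
  have h43 : U 4 3 = 0 := hU.succ_left 3
  have h45 : U 4 5 = 0 := hU.succ_right 4
  obtain ⟨-, -, -, h44⟩ := hU.diag_eq
  rw [h43, h44] at hzero
  rw [h43, h45] at hone
  exact ⟨by linear_combination hzero, by linear_combination hone⟩

theorem column_four_of_mulVec_kernelVec (hU : IsCyclicallyAlternating U)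
    (hker : ∀ j, U *ᵥ kernelVec y m j = 0) :
    (16 - y ^ 2) * U 0 4 =
        (4 - 3 * y) * (4 + y) * U 0 0 + m * y * (4 + y) * U 0 2 - 2 * y * U 0 3 ∧
      (16 - y ^ 2) * U 1 4 = 8 * U 0 0 - 2 * y * U 1 3 ∧
      (16 - y ^ 2) * U 2 4 = (4 - 3 * y) * (4 + y) * U 2 0 + m * y * (4 + y) * U 0 0 := by
  have row₀ : U 0 ⬝ᵥ kernelVec y m 0 = 0 := congrFun (hker 0) 0
  have row₁ : U 1 ⬝ᵥ kernelVec y m 0 = 0 := congrFun (hker 0) 1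
  have row₂ : U 2 ⬝ᵥ kernelVec y m 0 = 0 := congrFun (hker 0) 2
  rw [dotProduct_kernelVec_zero] at row₀ row₁ row₂
  have h01 : U 0 1 = 0 := hU.succ_right 0
  have h10 : U 1 0 = 0 := hU.succ_left 0
  have h12 : U 1 2 = 0 := hU.succ_right 1
  have h21 : U 2 1 = 0 := hU.succ_left 1
  have h23 : U 2 3 = 0 := hU.succ_right 2
  obtain ⟨h11, h22, -, -⟩ := hU.diag_eq
  rw [h01] at row₀
  rw [h10, h11, h12] at row₁
  rw [h21, h22, h23] at row₂
  exact ⟨by linear_combination -row₀, by linear_combination -row₁, by linear_combination -row₂⟩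

variable [CharZero K]

theorem corner_relations (hU : IsCyclicallyAlternating U)
    (hy : y ^ 3 - 12 * y + 12 = 0) (hm : m ^ 2 = 2 - y + 2 / 3 * y ^ 2) (hm0 : m ≠ 0)
    (hr : ∀ j, U *ᵥ kernelVec y m j = 0) (hl : ∀ j, Uᵀ *ᵥ kernelVec y m j = 0) :
    (30 - 6 * y - 3 * y ^ 2) * U 0 0 + (4 - 4 * y - 2 * y ^ 2) * U 0 3 +
        (22 - 7 * y - 5 * y ^ 2) * U 3 0 = 0 ∧
      12 * (y ^ 2 - 16) * U 0 0 + (172 - 116 * y - 40 * y ^ 2) * (U 0 3 + U 3 0) = 0 := by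
  obtain ⟨h31, h02⟩ := hU.entries_of_mulVec_kernelVec hr
  obtain ⟨-, h20⟩ := hU.transpose.entries_of_mulVec_kernelVec hl
  obtain ⟨h44, h45⟩ := hU.row_four_of_mulVec_kernelVec hr
  obtain ⟨h40, h41, h42⟩ := hU.transpose.column_four_of_mulVec_kernelVec hl
  simp only [transpose_apply] at h20 h40 h41 h42
  -- Multiply the relations of row 4 by `16 - y ^ 2` and eliminate all entries but `U 0 0`, `U 0 3`
  -- and `U 3 0`; the multiples of `hy` and `hm` reduce the resulting coefficients.
  constructor
  · refine (mul_eq_zero.mp ?_).resolve_left hm0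
    linear_combination (16 - y ^ 2) * h45 + 2 * m * h40 + (y - 2) * m * h41 - 4 * h42 +
      m * y * (2 - y) / 4 * h31 + (3 * y - 4) * (4 + y) * h02 + m ^ 2 * y * (4 + y) / 2 * h20 +
      m * ((2 / 3 * y + 7 / 6) * U 0 0 + (1 / 3 * y ^ 2 + 11 / 12 * y + 11 / 6) * U 3 0 +
        3 * U 0 3) * hy +
      m * y * (4 + y) * (U 0 0 + (y - 2) / 2 * U 3 0) * hm
  · linear_combination (16 - y ^ 2) * h44 + (3 * y - 4) * (4 + y) * h40 + 8 * h41 -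
      m * y * (4 + y) * h42 - 2 * y * h31 +
      m * y * (3 * y - 4) * (4 + y) ^ 2 / 4 * (h02 + h20) +
      ((4 / 3 * y ^ 3 + 6 * y ^ 2 - 32 / 3) * U 0 0 +
        (1 / 2 * y ^ 4 + 19 / 12 * y ^ 3 + 10 * y + 43 / 3) * (U 0 3 + U 3 0)) * hy +
      ((2 * y ^ 4 + 12 * y ^ 3 - 64 * y) * U 0 0 +
        (3 / 4 * y ^ 5 + 7 / 2 * y ^ 4 - 6 * y ^ 3 - 24 * y ^ 2 + 32 * y) *
          (U 0 3 + U 3 0)) * hm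

theorem corner_eq_zero (hU : IsCyclicallyAlternating U)
    (hy : y ^ 3 - 12 * y + 12 = 0) (hm : m ^ 2 = 2 - y + 2 / 3 * y ^ 2) (hm0 : m ≠ 0)
    (hr : ∀ j, U *ᵥ kernelVec y m j = 0) (hl : ∀ j, Uᵀ *ᵥ kernelVec y m j = 0) :
    U 0 0 = 0 ∧ U 0 3 = 0 ∧ U 3 0 = 0 := by
  obtain ⟨h₁, h₂⟩ := hU.corner_relations hy hm hm0 hr hl
  obtain ⟨h₃, -⟩ := hU.transpose.corner_relations hy hm hm0 hl (by rwa [transpose_transpose])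
  simp only [transpose_apply] at h₃
  have hsymm : U 0 3 = U 3 0 := by
    have hprod : (y + 3) * (y - 2) * (U 0 3 - U 3 0) = 0 := by
      linear_combination (h₁ - h₃) / 3
    have hne : (y + 3) * (y - 2) ≠ 0 := fun h => by grind
    exact sub_eq_zero.mp ((mul_eq_zero.mp hprod).resolve_left hne)
  -- Cramer's rule: modulo the cubic equation, the system `h₁`, `h₂` has determinant
  -- `96 * (2 * y - 1) * (y + 4)`.
  have hdet : (2 * y - 1) * (y + 4) ≠ 0 := fun h => by grind
  rw [hsymm] at h₁ h₂
  have hcorner : U 0 0 = 0 := by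
    refine (mul_eq_zero.mp ?_).resolve_left hdet
    linear_combination (344 - 232 * y - 80 * y ^ 2) / 96 * h₁ -
      (26 - 11 * y - 7 * y ^ 2) / 96 * h₂ - (27 * y + 109) / 8 * U 0 0 * hy
  have h30 : U 3 0 = 0 := by
    refine (mul_eq_zero.mp ?_).resolve_left hdet
    linear_combination (30 - 6 * y - 3 * y ^ 2) / 96 * h₂ -
      (y ^ 2 - 16) / 8 * h₁ - (27 * y + 109) / 8 * U 3 0 * hy
  exact ⟨hcorner, hsymm.trans h30, h30⟩

theorem submatrix_castAdd_eq_zero (hU : IsCyclicallyAlternating U)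
    (hy : y ^ 3 - 12 * y + 12 = 0) (hm : m ^ 2 = 2 - y + 2 / 3 * y ^ 2) (hm0 : m ≠ 0)
    (hr : ∀ j, U *ᵥ kernelVec y m j = 0) (hl : ∀ j, Uᵀ *ᵥ kernelVec y m j = 0) :
    U.submatrix (Fin.castAdd 2 : Fin 4 → Fin 6) (Fin.castAdd 2) = 0 := by
  obtain ⟨h00, h03, h30⟩ := hU.corner_eq_zero hy hm hm0 hr hl
  obtain ⟨h31, h02⟩ := hU.entries_of_mulVec_kernelVec hr
  obtain ⟨h13, h20⟩ := hU.transpose.entries_of_mulVec_kernelVec hl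
  obtain ⟨h11, h22, h33, -⟩ := hU.diag_eq
  have off₀ : U 0 1 = 0 := hU.succ_right 0
  have off₁ : U 1 2 = 0 := hU.succ_right 1
  have off₂ : U 2 3 = 0 := hU.succ_right 2
  have off₀' : U 1 0 = 0 := hU.succ_left 0
  have off₁' : U 2 1 = 0 := hU.succ_left 1
  have off₂' : U 3 2 = 0 := hU.succ_left 2
  simp only [transpose_apply, h00, h03, h30, mul_zero, add_zero, sub_zero, neg_zero, mul_eq_zero,
    OfNat.ofNat_ne_zero, false_or] at h31 h02 h13 h20 h11 h22 h33
  ext i j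
  fin_cases i <;> fin_cases j <;> assumption

end IsCyclicallyAlternating

end Rigidity

section Coefficients

/-- The parameters of the construction: `y = 6 μ₄` and `m = 6 μ₁`. -/
structure IsParameterPair (y m : ℝ) : Prop where
  cubic : y ^ 3 - 12 * y + 12 = 0
  lower : 1.11574 < y
  upper : y < 1.11576
  pos : 0 < m
  sq : m ^ 2 = 2 - y + 2 / 3 * y ^ 2

variable {y m : ℝ}

theorem IsParameterPair.lt_two (h : IsParameterPair y m) : m < 2 := by
  nlinarith [h.lower, h.upper, h.pos, h.sq]

/-- The Gram matrix, in real form, of the off-diagonal part of the Choi matrix. -/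
noncomputable def gram (y m : ℝ) : Matrix (Fin 6) (Fin 6) ℝ :=
  (1 / 6 : ℝ) • !![2, 0, m, 0, y, 0;
    0, 4, 0, -y, -2, m;
    m, 0, 2, 0, m, 2 - y ^ 2 / 6;
    0, -y, 0, 4, 0, m;
    y, -2, m, 0, 2, 0;
    0, m, 2 - y ^ 2 / 6, m, 0, 4]

/-- Orthogonal coordinates for `gram y m`, before the normalisation by `weight y m`. -/
def rawProfile (y m : ℝ) : Fin 4 → Fin 6 → ℝ :=
  ![![y * (2 + m), 0, y * (2 + m), 0, y * (y + m), 2],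
    ![y * (2 - m), 0, -(y * (2 - m)), 0, y * (y - m), -2],
    ![0, 4 - y, 0, 4 - y, -2, 2 * m],
    ![0, 4 + y, 0, -(4 + y), -2, 0]]

/-- The weights for which `gram y m = ∑ k, weight y m k • vecMulVec q_k q_k`, where the `q_k` are
the rows of `rawProfile y m`. -/
noncomputable def weight (y m : ℝ) : Fin 4 → ℝ :=
  ![1 / (12 * y ^ 2 * (2 + m)), 1 / (12 * y ^ 2 * (2 - m)), 1 / (12 * (4 - y)), 1 / (12 * (4 + y))]

/-- A real square root of `gram y m` with four columns. -/
noncomputable def profile (y m : ℝ) : Matrix (Fin 6) (Fin 4) ℝ :=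
  of fun a k => √(weight y m k) * rawProfile y m k a

namespace IsParameterPair

theorem weight_pos (h : IsParameterPair y m) (k : Fin 4) : 0 < weight y m k := by
  have hy : 0 < y := by linarith [h.lower]
  have hy' : 0 < 4 - y := by linarith [h.upper]
  have hm := h.pos
  have hm' : 0 < 2 - m := sub_pos.mpr h.lt_two
  fin_cases k <;> simp only [weight] <;> (dsimp; positivity)

theorem profile_mul_transpose (h : IsParameterPair y m) :
    profile y m * (profile y m)ᵀ = gram y m := by
  have hsq (k : Fin 4) (a b : Fin 6) :
      √(weight y m k) * rawProfile y m k a * (√(weight y m k) * rawProfile y m k b) =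
        weight y m k * (rawProfile y m k a * rawProfile y m k b) := by
    rw [mul_mul_mul_comm, Real.mul_self_sqrt (h.weight_pos k).le]
  have hy : y ≠ 0 := by linarith [h.lower]
  have hy₁ : 4 - y ≠ 0 := by linarith [h.upper]
  have hy₂ : 4 + y ≠ 0 := by linarith [h.lower]
  have hm₁ : 2 - m ≠ 0 := by linarith [h.lt_two]
  have hm₂ : 2 + m ≠ 0 := by linarith [h.pos]
  have hcubic := h.cubic
  have hsq' := h.sq
  ext a b
  simp only [Matrix.mul_apply, transpose_apply, profile, of_apply, hsq, Fin.sum_univ_four]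
  fin_cases a <;> fin_cases b <;> simp [weight, rawProfile, gram] <;> field_simp <;> grind

theorem transpose_profile_mulVec_kernelVec (h : IsParameterPair y m) (j : Fin 2) :
    (profile y m)ᵀ *ᵥ kernelVec y m j = 0 := by
  have hraw (k : Fin 4) : rawProfile y m k ⬝ᵥ kernelVec y m j = 0 := by
    have hcubic := h.cubic
    have hsq := h.sq
    fin_cases k <;> fin_cases j <;>
      simp [rawProfile, dotProduct, kernelVec, Fin.sum_univ_six] <;> grind
  ext k
  have : (profile y m)ᵀ k = √(weight y m k) • rawProfile y m k := rfl
  rw [mulVec, this, smul_dotProduct, hraw, smul_zero, Pi.zero_apply]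

theorem eq_zero_of_sum_mul_rawProfile (h : IsParameterPair y m) {u : Fin 4 → ℂ}
    (hu : ∀ a : Fin 4, ∑ k, u k * (rawProfile y m k (Fin.castAdd 2 a) : ℂ) = 0) : u = 0 := by
  have hy : (y : ℂ) ≠ 0 := by exact_mod_cast (by linarith [h.lower] : y ≠ 0)
  have hy₁ : (4 - y : ℂ) ≠ 0 := by exact_mod_cast (by linarith [h.upper] : 4 - y ≠ 0)
  have hy₂ : (4 + y : ℂ) ≠ 0 := by exact_mod_cast (by linarith [h.lower] : 4 + y ≠ 0)
  have hm₁ : (2 - m : ℂ) ≠ 0 := by exact_mod_cast (by linarith [h.lt_two] : 2 - m ≠ 0)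
  have hm₂ : (2 + m : ℂ) ≠ 0 := by exact_mod_cast (by linarith [h.pos] : 2 + m ≠ 0)
  have eq₀ : u 0 * (y * (2 + m)) + u 1 * (y * (2 - m)) = 0 := by
    simpa [Fin.sum_univ_four, rawProfile] using hu 0
  have eq₁ : u 2 * (4 - y) + u 3 * (4 + y) = 0 := by
    simpa [Fin.sum_univ_four, rawProfile] using hu 1
  have eq₂ : u 0 * (y * (2 + m)) + u 1 * -(y * (2 - m)) = 0 := by
    simpa [Fin.sum_univ_four, rawProfile] using hu 2
  have eq₃ : u 2 * (4 - y) + u 3 * -(4 + y) = 0 := by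
    simpa [Fin.sum_univ_four, rawProfile] using hu 3
  have u₀ : u 0 = 0 := (mul_eq_zero.mp (by linear_combination (eq₀ + eq₂) / 2)).resolve_right
    (mul_ne_zero hy hm₂)
  have u₁ : u 1 = 0 := (mul_eq_zero.mp (by linear_combination (eq₀ - eq₂) / 2)).resolve_right
    (mul_ne_zero hy hm₁)
  have u₂ : u 2 = 0 := (mul_eq_zero.mp (by linear_combination (eq₁ + eq₃) / 2)).resolve_right hy₁
  have u₃ : u 3 = 0 := (mul_eq_zero.mp (by linear_combination (eq₁ - eq₃) / 2)).resolve_right hy₂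
  ext k
  fin_cases k <;> assumption

theorem linearIndependent_col_profile_castAdd (h : IsParameterPair y m) :
    LinearIndependent ℂ
      (((profile y m).map Complex.ofReal).submatrix (Fin.castAdd 2 : Fin 4 → Fin 6) id).col := by
  refine Fintype.linearIndependent_iff.mpr fun c hc k => ?_
  have hzero := h.eq_zero_of_sum_mul_rawProfile (u := fun k => c k * (√(weight y m k) : ℂ))
    fun a => by simpa [Finset.sum_apply, profile, mul_assoc] using congrFun hc a
  refine (mul_eq_zero.mp (congrFun hzero k)).resolve_right ?_
  exact_mod_cast (Real.sqrt_pos.mpr (h.weight_pos k)).ne'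

end IsParameterPair

end Coefficients

section Kraus

open Complex in
/-- The phases by which the real model is twisted to produce the Ansatz of the matrix `matX`. -/
def phase : Fin 6 → ℂ :=
  ![1, -I, I, -I, 1, 1]

theorem phase_mul_star (a : Fin 6) : phase a * star (phase a) = 1 := by
  fin_cases a <;> simp [phase]

theorem diagonal_phase_mul_mul_apply (U : Matrix (Fin 6) (Fin 6) ℂ) (a b : Fin 6) :
    (diagonal phase * U * (diagonal phase)ᴴ) a b = phase a * U a b * star (phase b) := by
  simp

theorem diagonal_phase_mul_mul_apply_self (U : Matrix (Fin 6) (Fin 6) ℂ) (a : Fin 6) :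
    (diagonal phase * U * (diagonal phase)ᴴ) a a = U a a := by
  rw [diagonal_phase_mul_mul_apply, mul_right_comm, phase_mul_star, one_mul]

theorem isCyclicallyAlternating_of_diagonal_phase {U : Matrix (Fin 6) (Fin 6) ℂ}
    (h : IsCyclicallyAlternating (diagonal phase * U * (diagonal phase)ᴴ)) :
    IsCyclicallyAlternating U := by
  have hne (a : Fin 6) : phase a ≠ 0 := left_ne_zero_of_mul_eq_one (phase_mul_star a)
  refine ⟨fun a => ?_, fun a => ?_, fun a => ?_⟩
  · simpa [hne] using (diagonal_phase_mul_mul_apply U _ _).symm.trans (h.succ_right a)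
  · simpa [hne] using (diagonal_phase_mul_mul_apply U _ _).symm.trans (h.succ_left a)
  · simpa only [diagonal_phase_mul_mul_apply_self] using h.diag a

variable {y m : ℝ}

/-- The Kraus operators in the coordinates of `offDiag`: the rows of the square root
`profile y m`, twisted by the phases. -/
noncomputable def krausCoeff (y m : ℝ) : Matrix (Fin 6) (Fin 4) ℂ :=
  diagonal phase * (profile y m).map Complex.ofReal

/-- The Kraus operators of the extremal unital channel. -/
noncomputable def kraus (y m : ℝ) (k : Fin 4) : Mat 3 :=
  offDiag ((krausCoeff y m).col k)

theorem conjTranspose_map_ofReal {m n : Type*} (M : Matrix m n ℝ) :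
    (M.map Complex.ofReal)ᴴ = Mᵀ.map Complex.ofReal := by
  ext i j
  simp

theorem krausCoeff_mul_mul_conjTranspose (g : Matrix (Fin 4) (Fin 4) ℂ) :
    krausCoeff y m * g * (krausCoeff y m)ᴴ = diagonal phase *
      ((profile y m).map Complex.ofReal * g * ((profile y m).map Complex.ofReal)ᴴ) *
        (diagonal phase)ᴴ := by
  simp only [krausCoeff, conjTranspose_mul, Matrix.mul_assoc]

theorem IsParameterPair.krausCoeff_mul_conjTranspose (h : IsParameterPair y m) :
    krausCoeff y m * (krausCoeff y m)ᴴ =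
      diagonal phase * (gram y m).map Complex.ofReal * (diagonal phase)ᴴ := by
  have hgram := krausCoeff_mul_mul_conjTranspose (y := y) (m := m) 1
  rw [Matrix.mul_one, Matrix.mul_one] at hgram
  rw [hgram, conjTranspose_map_ofReal, ← h.profile_mul_transpose]
  congr 2
  exact (Matrix.map_mul (f := Complex.ofRealHom)).symm

theorem IsParameterPair.krausDual_kraus_one (h : IsParameterPair y m) :
    krausDual (kraus y m) 1 = 1 := by
  unfold kraus
  rw [krausDual_offDiag, Matrix.mul_one, h.krausCoeff_mul_conjTranspose, ← diagonal_one]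
  ext i j
  fin_cases i <;> fin_cases j <;>
    simp [diagonal_phase_mul_mul_apply_self, diagonal_phase_mul_mul_apply, gram,
      -diagonal_conjTranspose, -mul_diagonal] <;> norm_num

theorem IsParameterPair.krausForm_kraus_one_apply_one (h : IsParameterPair y m) :
    krausForm (kraus y m) 1 1 = 1 := by
  unfold kraus
  rw [krausForm_offDiag_one, Matrix.mul_one, h.krausCoeff_mul_conjTranspose]
  ext i j
  fin_cases i <;> fin_cases j <;>
    simp [diagonal_phase_mul_mul_apply_self, diagonal_phase_mul_mul_apply, gram,
      -diagonal_conjTranspose, -mul_diagonal] <;> norm_num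

theorem IsParameterPair.krausForm_kraus_one_mem_unitalChannels (h : IsParameterPair y m) :
    krausForm (kraus y m) 1 ∈ unitalChannels 3 :=
  ⟨krausForm_mem_channels PosSemidef.one h.krausDual_kraus_one, h.krausForm_kraus_one_apply_one⟩

theorem IsParameterPair.transpose_profile_map_mulVec_kernelVec (h : IsParameterPair y m)
    (j : Fin 2) : (profile y m)ᵀ.map Complex.ofReal *ᵥ kernelVec (y : ℂ) m j = 0 := by
  have hcast : kernelVec (y : ℂ) m j = Complex.ofReal ∘ kernelVec y m j := by
    ext a
    fin_cases j <;> fin_cases a <;> simp [kernelVec]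
  ext k
  rw [hcast]
  refine (RingHom.map_mulVec Complex.ofRealHom _ _ k).symm.trans ?_
  rw [h.transpose_profile_mulVec_kernelVec]
  simp

theorem IsParameterPair.linearIndependent_krausProducts_kraus (h : IsParameterPair y m) :
    LinearIndependent ℂ (krausProducts (kraus y m)) := by
  refine linearIndependent_krausProducts_iff.mpr fun g hdual hone => ?_
  set P := (profile y m).map Complex.ofReal
  have hker (j : Fin 2) : Pᵀ *ᵥ kernelVec (y : ℂ) m j = 0 :=
    h.transpose_profile_map_mulVec_kernelVec j
  have hreal : Pᴴ = Pᵀ := conjTranspose_map_ofReal _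
  have hU : IsCyclicallyAlternating (P * g * Pᵀ) := by
    refine isCyclicallyAlternating_of_diagonal_phase ?_
    rw [← hreal, ← krausCoeff_mul_mul_conjTranspose]
    exact isCyclicallyAlternating_of_krausDual_eq_zero hdual hone
  have hcubic : (y : ℂ) ^ 3 - 12 * y + 12 = 0 := by exact_mod_cast h.cubic
  have hsq : (m : ℂ) ^ 2 = 2 - y + 2 / 3 * y ^ 2 := by
    rw [← Complex.ofReal_pow, h.sq]
    push_cast
    rfl
  have hpivot := hU.submatrix_castAdd_eq_zero hcubic hsq (by exact_mod_cast h.pos.ne')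
    (fun j => by rw [← mulVec_mulVec, hker, mulVec_zero])
    (fun j => by rw [transpose_mul, transpose_mul, transpose_transpose, ← mulVec_mulVec,
      ← mulVec_mulVec, hker, mulVec_zero, mulVec_zero])
  refine eq_zero_of_mul_mul_conjTranspose_eq_zero h.linearIndependent_col_profile_castAdd ?_
  rwa [← hreal] at hpivot

end Kraus

section Ansatz

theorem sum_sum_smul_ketBra {ι κ : Type*} [Fintype ι] (M : Matrix ι ι ℂ) (v : ι → κ → ℂ) :
    ∑ i, ∑ j, M i j • ketBra (v i) (v j) = (of v)ᵀ * M * (of v)ᵀᴴ := by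
  ext p q
  simp only [Matrix.sum_apply, Matrix.smul_apply, ketBra, vecMulVec_apply, Pi.star_apply,
    smul_eq_mul, Matrix.mul_apply, transpose_apply, conjTranspose_apply, of_apply, Finset.sum_mul]
  rw [Finset.sum_comm]
  exact Finset.sum_congr rfl fun j _ => Finset.sum_congr rfl fun i _ => by ring

open Complex in
/-- The unitary matrix whose columns are the vectors `ψ_1, …, ψ_6`, in the off-diagonal product
basis `offDiagIndex`. -/
noncomputable def psiCoord : Matrix (Fin 6) (Fin 6) ℂ :=
  (1 / (√2 : ℂ)) • !![1, 0, 0, -I, 0, 0;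
    0, 1, 0, 0, -I, 0;
    0, 0, 1, 0, 0, -I;
    1, 0, 0, I, 0, 0;
    0, 1, 0, 0, I, 0;
    0, 0, 1, 0, 0, I]

theorem offDiagEmbedding_mul_psiCoord : offDiagEmbedding * psiCoord = (of psi)ᵀ := by
  ext ⟨j, k⟩ i
  fin_cases j <;> fin_cases k <;> fin_cases i <;>
    simp [offDiagEmbedding_apply, offDiagIndex, psiCoord, psi, ket, Matrix.mul_apply,
      Fin.sum_univ_six, mul_comm Complex.I]

theorem conjTranspose_psiCoord_mul_self : psiCoordᴴ * psiCoord = 1 := by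
  have hsqrt : (√2 : ℂ) * √2 = 2 := by
    rw [← Complex.ofReal_mul, Real.mul_self_sqrt zero_le_two, Complex.ofReal_ofNat]
  simp only [psiCoord, conjTranspose_smul, Matrix.smul_mul, Matrix.mul_smul, smul_smul]
  ext i j
  fin_cases i <;> fin_cases j <;>
    simp [Matrix.mul_apply, Fin.sum_univ_six, ← mul_inv, hsqrt] <;> norm_num

/-- The matrix `X` of the Ansatz as a function of `y = 6 μ₄` and `m = 6 μ₁`. -/
noncomputable abbrev ansatz (y m : ℝ) : Matrix (Fin 6) (Fin 6) ℂ :=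
  matX (m / 6) (-(1 - y ^ 2 / 12) / 6) (1 / 6) (y / 6)

variable {y m : ℝ}

theorem IsParameterPair.psiCoord_mul_ansatz (h : IsParameterPair y m) :
    psiCoord * ansatz y m =
      (1 / 3 : ℂ) • (krausCoeff y m * (krausCoeff y m)ᴴ * psiCoord) := by
  rw [h.krausCoeff_mul_conjTranspose, psiCoord, Matrix.smul_mul, Matrix.mul_smul, smul_comm]
  congr 1
  ext a j
  rw [Matrix.smul_apply, Matrix.mul_apply, Matrix.mul_apply, Fin.sum_univ_six, Fin.sum_univ_six]
  simp only [diagonal_phase_mul_mul_apply]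
  fin_cases a <;> fin_cases j <;>
    simp [ansatz, matX, gram, phase] <;> grind [Complex.I_mul_I]

theorem IsParameterPair.ansatz_eq_smul (h : IsParameterPair y m) :
    ansatz y m =
      (1 / 3 : ℂ) • ((psiCoordᴴ * krausCoeff y m) * (psiCoordᴴ * krausCoeff y m)ᴴ) := by
  rw [conjTranspose_mul, conjTranspose_conjTranspose, ← Matrix.mul_assoc,
    Matrix.mul_assoc psiCoordᴴ, Matrix.mul_assoc psiCoordᴴ, ← Matrix.mul_smul,
    ← h.psiCoord_mul_ansatz, ← Matrix.mul_assoc, conjTranspose_psiCoord_mul_self, Matrix.one_mul]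

theorem IsParameterPair.posSemidef_ansatz (h : IsParameterPair y m) :
    (ansatz y m).PosSemidef := by
  rw [h.ansatz_eq_smul]
  exact (posSemidef_self_mul_conjTranspose _).smul (by positivity)

theorem IsParameterPair.linearIndependent_kraus (h : IsParameterPair y m) :
    LinearIndependent ℂ (kraus y m) :=
  linearIndependent_of_krausProducts h.linearIndependent_krausProducts_kraus

theorem IsParameterPair.rank_krausCoeff (h : IsParameterPair y m) : (krausCoeff y m).rank = 4 := by
  have hcol : LinearIndependent ℂ (krausCoeff y m).col :=
    h.linearIndependent_kraus.of_comp offDiag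
  rw [← rank_transpose, LinearIndependent.rank_matrix hcol, Fintype.card_fin]

theorem IsParameterPair.rank_ansatz (h : IsParameterPair y m) :
    (ansatz y m).rank = 4 := by
  have hunit : IsUnit psiCoordᴴ.det :=
    isUnit_det_of_right_inverse conjTranspose_psiCoord_mul_self
  rw [h.ansatz_eq_smul, rank_smul_of_mem_nonZeroDivisors _ (by simp), rank_self_mul_conjTranspose,
    rank_mul_eq_right_of_isUnit_det _ _ hunit, h.rank_krausCoeff]

theorem IsParameterPair.jamiolkowski_krausForm_kraus_one (h : IsParameterPair y m) :
    jamiolkowski (krausForm (kraus y m) 1) =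
      ∑ i, ∑ j, ansatz y m i j •
        ketBra (psi i) (psi j) := by
  have hunitary : psiCoord * psiCoordᴴ = 1 := mul_eq_one_comm.mp conjTranspose_psiCoord_mul_self
  calc jamiolkowski (krausForm (kraus y m) 1)
      = offDiagEmbedding * ((1 / 3 : ℂ) • (krausCoeff y m * (krausCoeff y m)ᴴ)) *
          offDiagEmbeddingᴴ := by
        rw [jamiolkowski_eq_smul_choi]
        unfold kraus
        rw [choi_krausForm_offDiag, Matrix.mul_one, Matrix.mul_smul, Matrix.smul_mul]
        rfl
    _ = offDiagEmbedding * (psiCoord * ansatz y m *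
          psiCoordᴴ) * offDiagEmbeddingᴴ := by
        rw [h.psiCoord_mul_ansatz, Matrix.smul_mul, Matrix.mul_assoc _ psiCoord, hunitary,
          Matrix.mul_one]
    _ = _ := by
        rw [sum_sum_smul_ketBra, ← offDiagEmbedding_mul_psiCoord, conjTranspose_mul]
        simp only [Matrix.mul_assoc]

end Ansatz
section Parameters

theorem exists_cubic_root :
    ∃ y : ℝ, y ^ 3 - 12 * y + 12 = 0 ∧ y ∈ Set.Ioo 1.11574 1.11576 := by
  have hc : ContinuousOn (fun y : ℝ => y ^ 3 - 12 * y + 12) (Set.Icc 1.11574 1.11576) := by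
    fun_prop
  obtain ⟨y, hy, hzero⟩ := intermediate_value_Ioo' (by norm_num) hc
    (show (0 : ℝ) ∈ Set.Ioo _ _ by constructor <;> norm_num)
  exact ⟨y, hzero, hy⟩

theorem exists_neg_cubic_root : ∃ y : ℝ, y ^ 3 - 12 * y + 12 = 0 ∧ y < 0 := by
  have hc : ContinuousOn (fun y : ℝ => y ^ 3 - 12 * y + 12) (Set.Icc (-4) 0) := by
    fun_prop
  obtain ⟨y, hy, hzero⟩ := intermediate_value_Ioo (by norm_num) hc
    (show (0 : ℝ) ∈ Set.Ioo _ _ by constructor <;> norm_num)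
  exact ⟨y, hzero, hy.2⟩

theorem exists_isParameterPair : ∃ y m : ℝ, IsParameterPair y m := by
  obtain ⟨y, hcubic, hlower, hupper⟩ := exists_cubic_root
  have hpos : 0 < 2 - y + 2 / 3 * y ^ 2 := by nlinarith
  exact ⟨y, √(2 - y + 2 / 3 * y ^ 2), hcubic, hlower, hupper, Real.sqrt_pos.mpr hpos,
    Real.sq_sqrt hpos.le⟩

theorem isNthRealRoot_one {p : ℝ[X]} {x : ℝ} (hroot : p.eval x = 0)
    (hlt : ∀ t < x, p.eval t ≠ 0) : IsNthRealRoot 1 p x := by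
  refine ⟨?_, hroot, ?_⟩
  · rintro rfl
    exact hlt (x - 1) (by linarith) (by simp)
  · rw [Multiset.filter_eq_nil.mpr]
    · simp
    · intro t ht htx
      exact hlt t htx (isRoot_of_mem_roots ht)

theorem isNthRealRoot_two {a b c k : ℝ} (hk : k ≠ 0) (hab : a < b) (hbc : b < c) :
    IsNthRealRoot 2 (C k * ((X - C a) * (X - C b) * (X - C c))) b := by
  have hne : (X - C a) * (X - C b) * (X - C c) ≠ 0 :=
    mul_ne_zero (mul_ne_zero (X_sub_C_ne_zero a) (X_sub_C_ne_zero b)) (X_sub_C_ne_zero c)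
  refine ⟨mul_ne_zero (C_ne_zero.mpr hk) hne, by simp, ?_⟩
  rw [roots_C_mul _ hk, roots_mul hne,
    roots_mul (mul_ne_zero (X_sub_C_ne_zero a) (X_sub_C_ne_zero b))]
  simp [Multiset.filter_singleton, hab, hbc.le]

namespace IsParameterPair

variable {y m : ℝ}

theorem isNthRealRoot_radicand (h : IsParameterPair y m) :
    IsNthRealRoot 1 (-356 + 312 * X - 66 * X ^ 2 + 3 * X ^ 3) (m ^ 2) := by
  have hroot : -356 + 312 * m ^ 2 - 66 * (m ^ 2) ^ 2 + 3 * (m ^ 2) ^ 3 = 0 := by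
    have hcubic := h.cubic
    rw [h.sq]
    grind
  have hpos : 0 < m ^ 2 := pow_pos h.pos 2
  have hlt : m ^ 2 < 2 := by nlinarith [h.sq, h.lower, h.upper]
  refine isNthRealRoot_one (by simpa using hroot) fun t ht htroot => ?_
  have htroot' : -356 + 312 * t - 66 * t ^ 2 + 3 * t ^ 3 = 0 := by simpa using htroot
  have hfactor : 312 - 66 * (m ^ 2 + t) + 3 * ((m ^ 2) ^ 2 + m ^ 2 * t + t ^ 2) = 0 :=
    (mul_eq_zero.mp (by linear_combination hroot - htroot')).resolve_left (sub_pos.mpr ht).ne'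
  nlinarith [sq_nonneg (m ^ 2 - t), mul_pos (sub_pos.mpr ht) hpos]

theorem isNthRealRoot_mu_two (h : IsParameterPair y m) :
    IsNthRealRoot 1 (-1 + 432 * X ^ 2 + 2592 * X ^ 3) (-(1 - y ^ 2 / 12) / 6) := by
  set r := -(1 - y ^ 2 / 12) / 6 with hr
  have hlt : r < -0.149 := by nlinarith [h.lower, h.upper]
  have hroot : -1 + 432 * r ^ 2 + 2592 * r ^ 3 = 0 := by
    have hcubic := h.cubic
    rw [hr]
    grind
  refine isNthRealRoot_one (by simpa using hroot) fun t ht htroot => ?_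
  have htroot' : -1 + 432 * t ^ 2 + 2592 * t ^ 3 = 0 := by simpa using htroot
  have hfactor : 432 * (r + t) + 2592 * (r ^ 2 + r * t + t ^ 2) = 0 :=
    (mul_eq_zero.mp (by linear_combination hroot - htroot')).resolve_left (sub_pos.mpr ht).ne'
  nlinarith [sq_nonneg (r - t), mul_pos (sub_pos.mpr ht) (show 0 < -r by linarith)]

theorem isNthRealRoot_mu_four (h : IsParameterPair y m) :
    IsNthRealRoot 2 (1 - 6 * X + 18 * X ^ 3) (y / 6) := by
  obtain ⟨a, ha, hneg⟩ := exists_neg_cubic_root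
  have hlower := h.lower
  have hupper := h.upper
  have hsum : a ^ 2 + a * y + y ^ 2 = 12 := by
    have : (y - a) * (a ^ 2 + a * y + y ^ 2 - 12) = 0 := by linear_combination h.cubic - ha
    linarith [(mul_eq_zero.mp this).resolve_left (by linarith)]
  have hp : (1 - 6 * X + 18 * X ^ 3 : ℝ[X]) =
      C 18 * ((X - C (a / 6)) * (X - C (y / 6)) * (X - C ((-a - y) / 6))) := by
    refine Polynomial.funext fun t => ?_
    simp only [eval_add, eval_sub, eval_mul, eval_pow, eval_X, eval_C, eval_one, eval_ofNat]
    linear_combination t / 2 * hsum + 1 / 12 * (h.cubic - y * hsum)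
  rw [hp]
  refine isNthRealRoot_two (by norm_num) (by linarith) ?_
  have : a < -3 := by nlinarith
  linarith

theorem isSpecialParameters (h : IsParameterPair y m) :
    IsSpecialParameters (m / 6) (-(1 - y ^ 2 / 12) / 6) (1 / 6) (y / 6) :=
  ⟨⟨m ^ 2, h.isNthRealRoot_radicand, sq_nonneg m, by rw [Real.sqrt_sq h.pos.le]; ring⟩,
    h.isNthRealRoot_mu_two, rfl, h.isNthRealRoot_mu_four⟩

theorem abs_mu_one_sub_lt (h : IsParameterPair y m) : |m / 6 - 0.21821| < 1 / 10 ^ 5 := by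
  have hlower : 1.3092 < m :=
    lt_of_pow_lt_pow_left₀ 2 h.pos.le (by nlinarith [h.lower, h.upper, h.sq])
  have hupper : m < 1.3093 :=
    lt_of_pow_lt_pow_left₀ 2 (by norm_num) (by nlinarith [h.lower, h.upper, h.sq])
  rw [abs_lt]
  constructor <;> linarith

theorem abs_mu_two_sub_lt (h : IsParameterPair y m) :
    |-(1 - y ^ 2 / 12) / 6 - (-0.14937)| < 1 / 10 ^ 5 := by
  rw [abs_lt]
  constructor <;> nlinarith [h.lower, h.upper]

theorem abs_mu_four_sub_lt (h : IsParameterPair y m) : |y / 6 - 0.18595| < 1 / 10 ^ 5 := by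
  rw [abs_lt]
  constructor <;> linarith [h.lower, h.upper]

end IsParameterPair

end Parameters

end UnitalChannel

open UnitalChannel in
theorem mainTheorem8 :
    ∃ μ₁ μ₂ μ₃ μ₄ : ℝ,
      UnitalChannel.IsSpecialParameters μ₁ μ₂ μ₃ μ₄ ∧
      |μ₁ - 0.21821| < 1 / 10 ^ 5 ∧ |μ₂ - (-0.14937)| < 1 / 10 ^ 5 ∧
      |μ₄ - 0.18595| < 1 / 10 ^ 5 ∧
      (UnitalChannel.matX μ₁ μ₂ μ₃ μ₄).PosSemidef ∧
      (UnitalChannel.matX μ₁ μ₂ μ₃ μ₄).rank = 4 ∧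
      ∃ T : UnitalChannel.Mat 3 →ₗ[ℂ] UnitalChannel.Mat 3,
        T ∈ UnitalChannel.unitalChannels 3 ∧
        UnitalChannel.jamiolkowski T =
          ∑ i, ∑ j, UnitalChannel.matX μ₁ μ₂ μ₃ μ₄ i j •
            UnitalChannel.ketBra (UnitalChannel.psi i) (UnitalChannel.psi j) ∧
        (∃ A : Fin 4 → UnitalChannel.Mat 3,
          UnitalChannel.IsKrausDecomposition T A ∧
          LinearIndependent ℂ A ∧
          LinearIndependent ℂ (fun kl : Fin 4 × Fin 4 =>
            Matrix.fromBlocks ((A kl.1).conjTranspose * A kl.2) 0 0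
              (A kl.2 * (A kl.1).conjTranspose))) ∧
        T ∈ Set.extremePoints ℝ (UnitalChannel.unitalChannels 3) ∧
        T ∉ Set.extremePoints ℝ (UnitalChannel.channels 3) := by
  obtain ⟨y, m, h⟩ := exists_isParameterPair
  have hlin := h.linearIndependent_kraus
  have hdual := h.krausDual_kraus_one
  have hunital := h.krausForm_kraus_one_mem_unitalChannels
  have hprod := h.linearIndependent_krausProducts_kraus
  exact ⟨m / 6, -(1 - y ^ 2 / 12) / 6, 1 / 6, y / 6, h.isSpecialParameters,
    h.abs_mu_one_sub_lt, h.abs_mu_two_sub_lt, h.abs_mu_four_sub_lt,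
    h.posSemidef_ansatz, h.rank_ansatz, krausForm (kraus y m) 1, hunital,
    h.jamiolkowski_krausForm_kraus_one,
    ⟨kraus y m, isKrausDecomposition_krausForm_one hdual, hlin, hprod⟩,
    krausForm_one_mem_extremePoints_unitalChannels hunital hprod,
    krausForm_one_notMem_extremePoints_channels hlin hdual (by simp)⟩
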